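/- Let $a,b:\mathbb Z\to\mathbb R$ with $a_n>0$ for all $n$ and with $a-1$ and $b$ finitely supported, and put $(\tau f)(n)=a_{n-1}f(n-1)+a_nf(n+1)+b_nf(n)$. For $z\in\mathbb C\setminus\{0\}$ let $f^\pm(\cdot,z)$ be the Jost solutions, i.e. the solutions of $\tau f=(z+z^{-1})f$ with $f^\pm(n,z)=z^{\pm n}$ for all $n$ sufficiently close to $\pm\infty$. With $[f,g]=a_n(f(n)g(n+1)-f(n+1)g(n))$ (independent of $n$ for two solutions with the same $z+z^{-1}$), put $$w(z)=z[f^+(z),f^-(z)],\quad \alpha(z)=\frac{w(z)}{1-z^2},\quad \beta^\pm(z)=\pm\frac{z[f^\mp(z),f^\pm(z^{-1})]}{1-z^2},\quad \mathcal R^\pm=\frac{\beta^\pm}{\alpha},$$ so that the reflection coefficients $\mathcal R^\pm$ are rational functions of $z$. A half-bound state is a point $z\in\{1,-1\}$ with $w(z)=0$; an eigenvalue is a point $z$ with $0<|z|<1$ and $w(z)=0$. Theorem. Let $(a,b)$ and $(\tilde a,\tilde b)$ be two such pairs of sequences. Suppose that $(a,b)$ has at most one half-bound state or at least one eigenvalue,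 and that $(a,b)$ has at most one half-bound state if and only if $(\tilde a,\tilde b)$ does. Suppose further that, for at least one of the two signs, $\mathcal R^\pm$ and $\tilde{\mathcal R}^\pm$ have the same zeros and poles in $\mathbb C\setminus\{0\}$, counted with multiplicity, and that, if $(a,b)$ has a half-bound state, the orders of $\mathcal R^\pm$ and $\tilde{\mathcal R}^\pm$ at $z=0$ (same sign) differ by an even integer. Then there is $j\in\mathbb Z$ with $\tilde a_n=a_{n-j}$ and $\tilde b_n=b_{n-j}$ for all $n\in\mathbb Z$. -/

import Mathlib

/-- Coefficients `a, b` of a Jacobi difference expression: real sequences on `ℤ` with `a n > 0`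
such that `a - 1` and `b` are finitely supported. -/
structure JacobiCoeff where
  a : ℤ → ℝ
  b : ℤ → ℝ
  a_pos : ∀ n, 0 < a n
  a_finite : (Function.support (fun n => a n - 1)).Finite
  b_finite : (Function.support b).Finite

namespace JacobiCoeff

/-- The Jacobi difference expression
`(τ f)(n) = a (n-1) f (n-1) + a n f (n+1) + b n f n`. -/
def tau (J : JacobiCoeff) (f : ℤ → ℂ) (n : ℤ) : ℂ :=
  (J.a (n - 1) : ℂ) * f (n - 1) + (J.a n : ℂ) * f (n + 1) + (J.b n : ℂ) * f n

/-- `f` solves `τ f = (z + z⁻¹) f`. -/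
def IsSolution (J : JacobiCoeff) (z : ℂ) (f : ℤ → ℂ) : Prop :=
  ∀ n, J.tau f n = (z + z⁻¹) * f n

/-- The Jost solution at `+∞`: it equals `z ^ n` for all large `n` (equivalently, for all `n`
to the right of the supports of `a - 1` and `b`). -/
def IsJostPlus (J : JacobiCoeff) (z : ℂ) (f : ℤ → ℂ) : Prop :=
  J.IsSolution z f ∧ ∃ N : ℤ, ∀ n, N ≤ n → f n = z ^ n

/-- The Jost solution at `-∞`: it equals `z ^ (-n)` for all very negative `n`. -/
def IsJostMinus (J : JacobiCoeff) (z : ℂ) (f : ℤ → ℂ) : Prop :=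
  J.IsSolution z f ∧ ∃ N : ℤ, ∀ n, n ≤ N → f n = z ^ (-n)

theorem exists_right (J : JacobiCoeff) : ∃ N : ℤ, ∀ n, N ≤ n → J.a n = 1 ∧ J.b n = 0 := by
  obtain ⟨A, hA⟩ := J.a_finite.bddAbove
  obtain ⟨B, hB⟩ := J.b_finite.bddAbove
  refine ⟨max A B + 1, fun n hn => ⟨?_, ?_⟩⟩
  · by_contra h
    have h1 : n ≤ A := hA (by simpa [Function.mem_support] using sub_ne_zero.mpr h)
    have := le_max_left A B
    omega
  · by_contra h
    have h1 : n ≤ B := hB (by simpa [Function.mem_support] using h)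
    have := le_max_right A B
    omega

theorem exists_jostPlus (J : JacobiCoeff) {z : ℂ} (hz : z ≠ 0) : ∃ f, J.IsJostPlus z f := by
  obtain ⟨N, hN⟩ := J.exists_right
  let g : ℕ → ℂ × ℂ := fun k => Nat.rec (z ^ N, z ^ (N + 1))
    (fun k p => (((z + z⁻¹ - (J.b (N - k) : ℂ)) * p.1 - (J.a (N - k) : ℂ) * p.2)
      / (J.a (N - k - 1) : ℂ), p.1)) k
  have hg : ∀ k : ℕ, g (k + 1) = (((z + z⁻¹ - (J.b (N - k) : ℂ)) * (g k).1
      - (J.a (N - k) : ℂ) * (g k).2) / (J.a (N - k - 1) : ℂ), (g k).1) := fun k => rfl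
  let f : ℤ → ℂ := fun n => if N ≤ n then z ^ n else (g (N - n).toNat).1
  have hfN : ∀ n, N ≤ n → f n = z ^ n := fun n hn => if_pos hn
  have hf1 : ∀ k : ℕ, f (N - k) = (g k).1 := by
    intro k
    rcases Nat.eq_zero_or_pos k with rfl | hk
    · simp [f, g]
    · have h1 : ¬ N ≤ N - k := by omega
      have h2 : (N - (N - (k : ℤ))).toNat = k := by omega
      simp only [f, if_neg h1, h2]
  have hf2 : ∀ k : ℕ, f (N - k + 1) = (g k).2 := by
    intro k
    cases k with
    | zero => simp [f, g]
    | succ k =>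
      rw [hg k, ← hf1 k]
      congr 1
      push_cast
      ring
  refine ⟨f, ?_, N, hfN⟩
  intro n
  unfold tau
  rcases lt_or_ge N n with h | h
  · have e1 := hfN (n - 1) (by omega)
    have e2 := hfN n (by omega)
    have e3 := hfN (n + 1) (by omega)
    rw [e1, e2, e3, (hN (n - 1) (by omega)).1, (hN n (by omega)).1, (hN n (by omega)).2,
      zpow_sub_one₀ hz, zpow_add_one₀ hz]
    push_cast
    ring
  · obtain ⟨k, hk⟩ : ∃ k : ℕ, n = N - k := ⟨(N - n).toNat, by omega⟩
    subst hk
    have e1 : f (N - k - 1) = (g (k + 1)).1 := by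
      rw [← hf1 (k + 1)]
      congr 1
      push_cast
      ring
    have ha : (J.a (N - k - 1) : ℂ) ≠ 0 := by exact_mod_cast (J.a_pos _).ne'
    rw [e1, hg k, hf1 k, hf2 k]
    dsimp only
    rw [mul_div_cancel₀ _ ha]
    ring

/-- For `z ≠ 0` the Jost solution at `+∞` exists and is unique. -/
theorem existsUnique_jostPlus (J : JacobiCoeff) {z : ℂ} (hz : z ≠ 0) :
    ∃! f, J.IsJostPlus z f := by
  obtain ⟨f, hf⟩ := J.exists_jostPlus hz
  refine ⟨f, hf, fun g hg => ?_⟩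
  obtain ⟨hf, N, hfN⟩ := hf
  obtain ⟨hg, M, hgM⟩ := hg
  have key : ∀ k : ℕ, g (max N M - k) = f (max N M - k)
      ∧ g (max N M - k + 1) = f (max N M - k + 1) := by
    intro k
    have h1 := le_max_left N M
    have h2 := le_max_right N M
    induction k with
    | zero =>
      constructor
      · rw [hfN _ (by simp), hgM _ (by simp)]
      · rw [hfN _ (by push_cast; omega), hgM _ (by push_cast; omega)]
    | succ k ih =>
      have e : max N M - ((k + 1 : ℕ) : ℤ) = max N M - k - 1 := by push_cast; ring
      rw [e]
      refine ⟨?_, by simpa using ih.1⟩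
      have ha : (J.a (max N M - k - 1) : ℂ) ≠ 0 := by exact_mod_cast (J.a_pos _).ne'
      have hf' := hf (max N M - k)
      have hg' := hg (max N M - k)
      unfold tau at hf' hg'
      rw [ih.1, ih.2] at hg'
      apply mul_left_cancel₀ ha
      linear_combination hg' - hf'
  funext n
  rcases le_total (max N M) n with h | h
  · rw [hfN _ (le_trans (le_max_left _ _) h), hgM _ (le_trans (le_max_right _ _) h)]
  · have := (key (max N M - n).toNat).1
    rwa [show max N M - ((max N M - n).toNat : ℤ) = n by omega] at this

/-- Reflection `n ↦ -n` of the coefficients. -/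
def reflect (J : JacobiCoeff) : JacobiCoeff where
  a n := J.a (-n - 1)
  b n := J.b (-n)
  a_pos n := J.a_pos _
  a_finite := by
    have : Function.Injective (fun n : ℤ => -n - 1) := fun m n h => by
      have : -m - 1 = -n - 1 := h
      omega
    exact J.a_finite.preimage this.injOn
  b_finite := J.b_finite.preimage neg_injective.injOn

theorem isJostMinus_iff (J : JacobiCoeff) (z : ℂ) (f : ℤ → ℂ) :
    J.IsJostMinus z f ↔ J.reflect.IsJostPlus z (fun n => f (-n)) := by
  unfold IsJostMinus IsJostPlus IsSolution
  refine and_congr ⟨fun h n => ?_, fun h n => ?_⟩ ⟨?_, ?_⟩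
  · have := h (-n)
    unfold tau reflect at *
    simp only [show -(n - 1) = -n + 1 by ring, show -(n + 1) = -n - 1 by ring,
      add_sub_cancel_right]
    linear_combination this
  · have := h (-n)
    unfold tau reflect at *
    simp only [show -(-n - 1) = n + 1 by ring, show -(-n + 1) = n - 1 by ring, neg_neg,
      add_sub_cancel_right] at this
    linear_combination this
  · rintro ⟨N, hN⟩
    exact ⟨-N, fun n hn => by simpa using hN (-n) (by omega)⟩
  · rintro ⟨N, hN⟩
    exact ⟨-N, fun n hn => by simpa using hN (-n) (by omega)⟩

/-- For `z ≠ 0` the Jost solution at `-∞` exists and is unique. -/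
theorem existsUnique_jostMinus (J : JacobiCoeff) {z : ℂ} (hz : z ≠ 0) :
    ∃! f, J.IsJostMinus z f := by
  obtain ⟨f, hf, huniq⟩ := J.reflect.existsUnique_jostPlus hz
  refine ⟨fun n => f (-n), ?_, fun g hg => ?_⟩
  · exact (J.isJostMinus_iff z _).2 (by simpa using hf)
  · have := huniq _ ((J.isJostMinus_iff z g).1 hg)
    funext n
    simpa using congrFun this (-n)

/-- The Jost solution `f⁺(·, z)`; only meaningful for `z ≠ 0`. -/
noncomputable def jostPlus (J : JacobiCoeff) (z : ℂ) : ℤ → ℂ :=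
  Classical.epsilon (J.IsJostPlus z)

/-- The Jost solution `f⁻(·, z)`; only meaningful for `z ≠ 0`. -/
noncomputable def jostMinus (J : JacobiCoeff) (z : ℂ) : ℤ → ℂ :=
  Classical.epsilon (J.IsJostMinus z)

theorem jostPlus_spec (J : JacobiCoeff) {z : ℂ} (hz : z ≠ 0) : J.IsJostPlus z (J.jostPlus z) :=
  Classical.epsilon_spec (J.existsUnique_jostPlus hz).exists

theorem jostMinus_spec (J : JacobiCoeff) {z : ℂ} (hz : z ≠ 0) :
    J.IsJostMinus z (J.jostMinus z) :=
  Classical.epsilon_spec (J.existsUnique_jostMinus hz).exists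

/-- The modified Wronskian `[f, g]_n = a n (f n g (n+1) - f (n+1) g n)`. -/
def wronskian (J : JacobiCoeff) (f g : ℤ → ℂ) (n : ℤ) : ℂ :=
  (J.a n : ℂ) * (f n * g (n + 1) - f (n + 1) * g n)

/-- The Wronskian of two solutions for the same `z + z⁻¹` does not depend on `n`. -/
theorem wronskian_eq_zero_index (J : JacobiCoeff) {z : ℂ} {f g : ℤ → ℂ}
    (hf : J.IsSolution z f) (hg : J.IsSolution z g) (n : ℤ) :
    J.wronskian f g n = J.wronskian f g 0 := by
  have step : ∀ n, J.wronskian f g n = J.wronskian f g (n - 1) := by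
    intro n
    have h1 := hf n
    have h2 := hg n
    unfold tau at h1 h2
    unfold wronskian
    rw [sub_add_cancel]
    linear_combination f n * h2 - g n * h1
  induction n with
  | zero => rfl
  | succ k ih => rw [step, add_sub_cancel_right, ih]
  | pred k ih => rw [← step, ih]

/-- `w(z) = z [f⁺(z), f⁻(z)]`. -/
noncomputable def w (J : JacobiCoeff) (z : ℂ) : ℂ :=
  z * J.wronskian (J.jostPlus z) (J.jostMinus z) 0

/-- `α(z) = z [f⁺(z), f⁻(z)] / (1 - z²)`. -/
noncomputable def alpha (J : JacobiCoeff) (z : ℂ) : ℂ :=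
  z * J.wronskian (J.jostPlus z) (J.jostMinus z) 0 / (1 - z ^ 2)

/-- `β⁺(z) = z [f⁻(z), f⁺(z⁻¹)] / (1 - z²)`. -/
noncomputable def betaPlus (J : JacobiCoeff) (z : ℂ) : ℂ :=
  z * J.wronskian (J.jostMinus z) (J.jostPlus z⁻¹) 0 / (1 - z ^ 2)

/-- `β⁻(z) = - z [f⁺(z), f⁻(z⁻¹)] / (1 - z²)`. -/
noncomputable def betaMinus (J : JacobiCoeff) (z : ℂ) : ℂ :=
  -(z * J.wronskian (J.jostPlus z) (J.jostMinus z⁻¹) 0 / (1 - z ^ 2))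

/-- The right reflection coefficient `R⁺ = β⁺ / α`, as a meromorphic function; its value at
`0`, `±1` and at the poles plays no role. -/
noncomputable def reflectionPlus (J : JacobiCoeff) (z : ℂ) : ℂ := J.betaPlus z / J.alpha z

/-- The left reflection coefficient `R⁻ = β⁻ / α`. -/
noncomputable def reflectionMinus (J : JacobiCoeff) (z : ℂ) : ℂ := J.betaMinus z / J.alpha z

/-- The half-bound states: the points `±1` at which `w` vanishes. -/
def halfBoundStates (J : JacobiCoeff) : Set ℂ := {z | (z = 1 ∨ z = -1) ∧ J.w z = 0}

/-- The eigenvalues, in the variable `z`: the zeros of `w` in the punctured open unit disk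
(`w` has no zero at the origin, where its Lean value is meaningless). -/
def eigenvalues (J : JacobiCoeff) : Set ℂ := {z | z ≠ 0 ∧ ‖z‖ < 1 ∧ J.w z = 0}

end JacobiCoeff

/-- `R` and `R'` have the same zeros and the same poles in `ℂ \ {0}`, with multiplicities. -/
def SameZerosAndPoles (R R' : ℂ → ℂ) : Prop :=
  ∀ z : ℂ, z ≠ 0 → meromorphicOrderAt R' z = meromorphicOrderAt R z

/-- The orders of `R` and `R'` at the origin differ by an even integer. -/
def SameParityAtZero (R R' : ℂ → ℂ) : Prop :=
  ∃ k : ℤ, meromorphicOrderAt R' 0 = meromorphicOrderAt R 0 + ((2 * k : ℤ) : WithTop ℤ)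

/-!
The functions `h n = z ^ n * f⁻(n, z)` are real polynomials in `z`. To the right of the supports of
`a - 1` and `b`, at an index `N`, the polynomials `W = h (N + 1) - X ^ 2 * h N` and
`S = h N - h (N + 1)` satisfy `w = W` and `R⁺ = z ^ (-2 * N) * S / W`.

Three facts about the pair `(W, S)` carry the proof (`IsScatteringPair`). Unitarity,
`W(z) W(z⁻¹) - S(z) S(z⁻¹) = (1 - z²) (1 - z⁻²)`, shows that `S / W` has modulus at most one on the
unit circle and that cancellation in `S / W` can occur at `±1` only. At `±1` one has `S = -W`, and
the zeros of `W` there are simple. Zeros `x` of `W` with `0 < |x| < 1` are real and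
`x * S(x) * W'(x) < 0` there, because the norming constants are positive.

Equality of zeros and poles of the two reflection coefficients says that `S' W` and `S W'` agree up
to a constant `c` and a power of `X`. If there is a point `±1` that is not a half-bound state, the
modulus of the reflection coefficient is one there, which forces `|c| = 1` and then, by unitarity,
`|W| = |W'|` on the circle; hence `W = W'`. If both points are half-bound states, then `W` and `W'`
have the same zeros, and unitarity at an eigenvalue gives the same conclusion. The sign of `c` is
read off from `S = -W` at a point that is not a half-bound state, or else from the sign condition at
an eigenvalue; the power of `X` is even, by comparison at both `±1` or by hypothesis
(`IsScatteringPair.eq_and_X_pow_mul_eq`). So `S'` and `S` differ by an even power of `X`, which is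
the effect of a shift.

Finally `W + S = (1 - X ^ 2) * h N` recovers the Jost polynomials far to the right, and these
determine `a` and `b` by layer stripping (`coeff_eq_of_eventually_eq`). Reflection `n ↦ -n`
exchanges `R⁺` and `R⁻`.
-/

open Polynomial

/-! ### Jost polynomials -/

/-- Induction from `-∞`. -/
theorem Int.forall_of_exists_forall_le {P : ℤ → Prop} (h0 : ∃ M, ∀ n ≤ M, P n)
    (hs : ∀ n, P (n - 1) → P n) (n : ℤ) : P n := by
  obtain ⟨M, hM⟩ := h0
  rcases le_total n M with h | h
  · exact hM n h
  · induction n, h using Int.leInduction with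
    | base => exact hM M le_rfl
    | succ k _ ih => exact hs _ (by simpa using ih)

namespace JacobiCoeff

/-- The functions `z ^ n * f⁻(n, z)` are real polynomials `h n` in `z`; this is the form which the
difference equation and the normalization at `-∞` take for them. -/
structure IsJostPolynomial (J : JacobiCoeff) (h : ℤ → ℝ[X]) : Prop where
  recurrence : ∀ n, C (J.a n) * h (n + 1)
    = (X ^ 2 + 1 - C (J.b n) * X) * h n - C (J.a (n - 1)) * X ^ 2 * h (n - 1)
  eventually_one : ∃ M : ℤ, ∀ n ≤ M, h n = 1

theorem exists_left (J : JacobiCoeff) : ∃ M : ℤ, ∀ n ≤ M, J.a n = 1 ∧ J.b n = 0 := by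
  obtain ⟨N, hN⟩ := J.reflect.exists_right
  refine ⟨-N - 1, fun n hn => ⟨?_, ?_⟩⟩
  · have := (hN (-n - 1) (by omega)).1
    simpa [reflect] using this
  · have := (hN (-n) (by omega)).2
    simpa [reflect] using this

theorem exists_isJostPolynomial (J : JacobiCoeff) : ∃ h, J.IsJostPolynomial h := by
  obtain ⟨M, hM⟩ := J.exists_left
  let g : ℕ → ℝ[X] × ℝ[X] := fun k => Nat.rec (1, 1)
    (fun k p => (p.2, C (J.a (M + k))⁻¹ * ((X ^ 2 + 1 - C (J.b (M + k)) * X) * p.2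
      - C (J.a (M + k - 1)) * X ^ 2 * p.1))) k
  have hg : ∀ k : ℕ, g (k + 1) = ((g k).2, C (J.a (M + k))⁻¹ *
      ((X ^ 2 + 1 - C (J.b (M + k)) * X) * (g k).2
        - C (J.a (M + k - 1)) * X ^ 2 * (g k).1)) := fun k => rfl
  have hC : ∀ n, C (J.a n) * C (J.a n)⁻¹ = 1 := fun n => by
    rw [← C_mul, mul_inv_cancel₀ (J.a_pos n).ne', C_1]
  refine ⟨fun n => (g (n - M).toNat).2, fun n => ?_, M, fun n hn => ?_⟩
  · rcases lt_or_ge n M with h | h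
    · rw [Int.toNat_of_nonpos (by omega), Int.toNat_of_nonpos (by omega),
        Int.toNat_of_nonpos (by omega), (hM n h.le).1, (hM n h.le).2, (hM (n - 1) (by omega)).1]
      simp [g]
    · obtain ⟨k, rfl⟩ : ∃ k : ℕ, n = M + k := ⟨(n - M).toNat, by omega⟩
      have e1 : (M + k + 1 - M : ℤ).toNat = k + 1 := by omega
      have e2 : (M + k - M : ℤ).toNat = k := by omega
      have e3 : (g (M + k - 1 - M : ℤ).toNat).2 = (g k).1 := by
        cases k with
        | zero => simp [g]
        | succ k =>
          rw [show (M + (k + 1 : ℕ) - 1 - M : ℤ).toNat = k by omega, hg]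
      rw [e1, e2, e3, hg, ← mul_assoc, hC, one_mul]
  · rw [Int.toNat_of_nonpos (by omega)]
    rfl

namespace IsJostPolynomial

variable {J : JacobiCoeff} {h : ℤ → ℝ[X]}

theorem exists_left (hh : J.IsJostPolynomial h) :
    ∃ M : ℤ, ∀ n ≤ M, J.a n = 1 ∧ h n = 1 ∧ h (n + 1) = 1 := by
  obtain ⟨M, hM⟩ := hh.eventually_one
  obtain ⟨M', hM'⟩ := J.exists_left
  refine ⟨min M M' - 1, fun n hn => ⟨(hM' n ?_).1, hM n ?_, hM (n + 1) ?_⟩⟩ <;> omega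

theorem recurrence_aeval (hh : J.IsJostPolynomial h) (z : ℂ) (n : ℤ) :
    (J.a n : ℂ) * aeval z (h (n + 1)) = (z ^ 2 + 1 - J.b n * z) * aeval z (h n)
      - J.a (n - 1) * z ^ 2 * aeval z (h (n - 1)) := by
  simpa using congrArg (aeval z) (hh.recurrence n)

theorem coeff_zero_succ (hh : J.IsJostPolynomial h) (n : ℤ) :
    J.a n * (h (n + 1)).coeff 0 = (h n).coeff 0 := by
  have := congrArg (eval 0) (hh.recurrence n)
  simpa [coeff_zero_eq_eval_zero] using this

theorem coeff_zero_pos (hh : J.IsJostPolynomial h) (n : ℤ) : 0 < (h n).coeff 0 := by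
  refine Int.forall_of_exists_forall_le (P := fun n => 0 < (h n).coeff 0) ?_ (fun n ih => ?_) n
  · obtain ⟨M, hM⟩ := hh.eventually_one
    exact ⟨M, fun n hn => by simp [hM n hn]⟩
  · have := hh.coeff_zero_succ (n - 1)
    rw [sub_add_cancel] at this
    rw [← this] at ih
    exact (pos_iff_pos_of_mul_pos ih).1 (J.a_pos _)

/-- The Wronskian of `f⁻(·, z)` and `f⁻(·, z⁻¹)`, computed at `-∞`. -/
theorem wronskian_inv (hh : J.IsJostPolynomial h) {z : ℂ} (hz : z ≠ 0) (n : ℤ) :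
    (J.a n : ℂ) * (z ^ 2 * aeval z (h n) * aeval z⁻¹ (h (n + 1))
      - aeval z (h (n + 1)) * aeval z⁻¹ (h n)) = z ^ 2 - 1 := by
  refine Int.forall_of_exists_forall_le (P := fun n => (J.a n : ℂ) *
      (z ^ 2 * aeval z (h n) * aeval z⁻¹ (h (n + 1))
      - aeval z (h (n + 1)) * aeval z⁻¹ (h n)) = z ^ 2 - 1) ?_ (fun n ih => ?_) n
  · obtain ⟨M, hM⟩ := hh.exists_left
    refine ⟨M, fun n hn => ?_⟩
    simp [hM n hn]
  · have h1 := hh.recurrence_aeval z n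
    have h2 := hh.recurrence_aeval z⁻¹ n
    rw [sub_add_cancel] at ih
    have hz' : z * z⁻¹ = 1 := mul_inv_cancel₀ hz
    generalize z⁻¹ = y at *
    linear_combination ih + z ^ 2 * aeval z (h n) * h2 - aeval y (h n) * h1 +
      (aeval z (h n) * aeval y (h n) * (z * y + 1 - J.b n * z)
       - J.a (n - 1) * (z * y + 1) * aeval z (h n) * aeval y (h (n - 1))) * hz'

/-- The Wronskian of `f⁻` and its `z`-derivative, multiplied by `X ^ (2 * n + 2)`. Iterated, this is
`(X ^ 2 - 1) * ∑ k ≤ n, X ^ (2 * (n - k)) * h k ^ 2`. -/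
theorem energy_succ (hh : J.IsJostPolynomial h) (n : ℤ) :
    C (J.a n) * (X * (h n * derivative (h (n + 1)) - h (n + 1) * derivative (h n))
        - h n * h (n + 1))
      = X ^ 2 * (C (J.a (n - 1)) * (X * (h (n - 1) * derivative (h n)
          - h n * derivative (h (n - 1))) - h (n - 1) * h n)) + (X ^ 2 - 1) * h n ^ 2 := by
  have h1 := hh.recurrence n
  have h2 := congrArg derivative h1
  have h3 : (C 2 : ℝ[X]) = 2 := rfl
  simp only [derivative_mul, derivative_C, derivative_sub, derivative_add, derivative_X,
    derivative_one, derivative_X_sq, h3] at h2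
  linear_combination X * h n * h2 - (X * derivative (h n) + h n) * h1

theorem energy_neg (hh : J.IsJostPolynomial h) {x : ℝ} (hx0 : x ≠ 0) (hx : x ^ 2 ≤ 1) (n : ℤ) :
    J.a n * (x * ((h n).eval x * (derivative (h (n + 1))).eval x
      - (h (n + 1)).eval x * (derivative (h n)).eval x) - (h n).eval x * (h (n + 1)).eval x)
      < 0 := by
  refine Int.forall_of_exists_forall_le (P := fun n => J.a n * (x *
      ((h n).eval x * (derivative (h (n + 1))).eval x
      - (h (n + 1)).eval x * (derivative (h n)).eval x) - (h n).eval x * (h (n + 1)).eval x)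
      < 0) ?_ (fun n ih => ?_) n
  · obtain ⟨M, hM⟩ := hh.exists_left
    refine ⟨M, fun n hn => ?_⟩
    simp [hM n hn]
  · have h1 := congrArg (eval x) (hh.energy_succ n)
    rw [sub_add_cancel] at ih
    simp only [eval_mul, eval_C, eval_sub, eval_add, eval_X, eval_pow, eval_one] at h1
    rw [h1]
    have h2 := mul_neg_of_pos_of_neg (pow_pos (abs_pos.2 hx0) 2) ih
    rw [sq_abs] at h2
    have h3 := mul_nonneg (sub_nonneg.2 hx) (sq_nonneg ((h n).eval x))
    linarith

/-- Up to a positive factor, the imaginary part of the Wronskian of `f⁻(·, z)` and its conjugate.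
Its sign excludes non-real eigenvalues. -/
theorem im_mul_pos (hh : J.IsJostPolynomial h) {z : ℂ} (hz0 : z ≠ 0) (hz : ‖z‖ ≤ 1)
    (him : z.im ≠ 0) (n : ℤ) :
    0 < z.im * (z * aeval z (h n) * (starRingEnd ℂ) (aeval z (h (n + 1)))).im := by
  suffices H : 0 < J.a n * (z.im * (z * aeval z (h n) *
      (starRingEnd ℂ) (aeval z (h (n + 1)))).im) from (pos_iff_pos_of_mul_pos H).1 (J.a_pos _)
  refine Int.forall_of_exists_forall_le (P := fun n => 0 < J.a n * (z.im * (z * aeval z (h n) *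
      (starRingEnd ℂ) (aeval z (h (n + 1)))).im)) ?_ (fun n ih => ?_) n
  · obtain ⟨M, hM⟩ := hh.exists_left
    refine ⟨M, fun n hn => ?_⟩
    simpa [hM n hn] using him
  · have h1 := hh.recurrence_aeval z n
    rw [sub_add_cancel] at ih
    have hn1 : z.re ^ 2 + z.im ^ 2 ≤ 1 := by
      have := Complex.sq_norm z
      rw [Complex.normSq_apply] at this
      nlinarith [norm_nonneg z]
    have hn0 : 0 < z.re ^ 2 + z.im ^ 2 := by positivity
    generalize aeval z (h (n + 1)) = p at *
    generalize aeval z (h n) = q at *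
    generalize aeval z (h (n - 1)) = r at *
    obtain ⟨x, y⟩ := z
    obtain ⟨p1, p2⟩ := p
    obtain ⟨q1, q2⟩ := q
    obtain ⟨r1, r2⟩ := r
    simp only [pow_two, Complex.ext_iff, Complex.add_re, Complex.sub_re, Complex.mul_re,
      Complex.add_im, Complex.sub_im, Complex.mul_im, Complex.ofReal_re, Complex.ofReal_im,
      Complex.one_re, Complex.one_im, Complex.conj_re, Complex.conj_im] at h1 ih hn0 hn1 him ⊢
    obtain ⟨h1, h2⟩ := h1
    have h3 := mul_pos hn0 ih
    have h4 : 0 ≤ y ^ 2 * ((1 - (x * x + y * y)) * (q1 ^ 2 + q2 ^ 2)) :=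
      mul_nonneg (sq_nonneg _) (mul_nonneg (by linarith) (by positivity))
    refine lt_of_lt_of_eq (add_pos_of_pos_of_nonneg h3 h4) ?_
    linear_combination (-y * (x * q2 + y * q1)) * h1 + (y * (x * q1 - y * q2)) * h2

end IsJostPolynomial
end JacobiCoeff

/-! ### Scattering pairs and layer stripping -/

/-- The properties of the numerator `S` and denominator `W` of a reflection coefficient on which the
uniqueness argument rests: `W 0 > 0`, unitarity, `S = -W` at `±1`, zeros of `W` at `±1` are simple,
zeros of `W` in the punctured open unit disk are real, and at each of them `S` and the derivative of
`W` are tied by a sign condition (positivity of the norming constant). -/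
structure IsScatteringPair (W S : ℝ[X]) : Prop where
  coeff_zero_pos : 0 < W.coeff 0
  unitarity : ∀ z : ℂ, z ≠ 0 →
    aeval z W * aeval z⁻¹ W - aeval z S * aeval z⁻¹ S = (1 - z ^ 2) * (1 - z⁻¹ ^ 2)
  eval_of_sq_eq_one : ∀ e : ℝ, e ^ 2 = 1 → S.eval e = -W.eval e
  derivative_ne_zero : ∀ e : ℝ, e ^ 2 = 1 → W.eval e = 0 → (derivative W).eval e ≠ 0
  im_eq_zero : ∀ z : ℂ, z ≠ 0 → ‖z‖ < 1 → aeval z W = 0 → z.im = 0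
  mul_derivative_neg : ∀ x : ℝ, x ≠ 0 → x ^ 2 < 1 → W.eval x = 0 →
    x * S.eval x * (derivative W).eval x < 0

theorem Polynomial.eval_derivative_sub_X_sq_mul (p q : ℝ[X]) (x : ℝ) :
    (derivative (p - X ^ 2 * q)).eval x
      = (derivative p).eval x - (2 * x * q.eval x + x ^ 2 * (derivative q).eval x) := by
  norm_num

namespace JacobiCoeff.IsJostPolynomial

variable {J J' : JacobiCoeff} {h h' : ℤ → ℝ[X]} {N : ℤ}

/-- At a zero `x` of `W` one has `h (N + 1) = x ^ 2 * h N`; with this the energy, which is negative,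
becomes `x * h N * W' + (x * h N) ^ 2`. This yields both simplicity at `±1` and the sign
condition. -/
theorem isScatteringPair (hh : J.IsJostPolynomial h) (ha : J.a N = 1) :
    IsScatteringPair (h (N + 1) - X ^ 2 * h N) (h N - h (N + 1)) where
  coeff_zero_pos := by
    have := hh.coeff_zero_pos (N + 1)
    simpa [coeff_X_pow] using this
  unitarity z hz := by
    have h1 := hh.wronskian_inv hz N
    have hz' : z * z⁻¹ = 1 := mul_inv_cancel₀ hz
    simp only [ha, Complex.ofReal_one, one_mul] at h1
    simp only [map_sub, map_mul, map_pow, aeval_X]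
    generalize z⁻¹ = y at *
    generalize aeval z (h N) = p at *
    generalize aeval z (h (N + 1)) = q at *
    generalize aeval y (h N) = p' at *
    generalize aeval y (h (N + 1)) = q' at *
    linear_combination (-1 + y ^ 2) * h1 + (z * y + 1) * (p * p' - p * q') * hz'
  eval_of_sq_eq_one e he := by
    simp only [eval_sub, eval_mul, eval_pow, eval_X, he]
    ring
  derivative_ne_zero e he h0 hd := by
    have h1 := hh.energy_neg (x := e) (by rintro rfl; norm_num at he) he.le N
    rw [eval_derivative_sub_X_sq_mul, he, one_mul] at hd
    simp only [ha, one_mul, eval_sub, eval_mul, eval_pow, eval_X, he] at h1 h0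
    have h2 : (h (N + 1)).eval e = (h N).eval e := by linarith
    have h3 : (derivative (h (N + 1))).eval e
        = 2 * e * (h N).eval e + (derivative (h N)).eval e := by linarith
    rw [h2, h3] at h1
    have h4 : 0 ≤ e ^ 2 * (h N).eval e ^ 2 := by positivity
    have h5 : e ^ 2 * (h N).eval e ^ 2 = (h N).eval e ^ 2 := by rw [he, one_mul]
    linarith
  im_eq_zero z hz hz1 h0 := by
    by_contra him
    have h1 := hh.im_mul_pos hz hz1.le him N
    simp only [map_sub, map_mul, map_pow, aeval_X, sub_eq_zero] at h0
    rw [h0] at h1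
    have h2 : z * aeval z (h N) * (starRingEnd ℂ) (z ^ 2 * aeval z (h N))
        = ((Complex.normSq z * Complex.normSq (aeval z (h N)) : ℝ) : ℂ) * (starRingEnd ℂ) z := by
      push_cast
      rw [← Complex.mul_conj, ← Complex.mul_conj, map_mul, map_pow]
      ring
    rw [h2, Complex.im_ofReal_mul, Complex.conj_im] at h1
    have := mul_nonneg (mul_nonneg (Complex.normSq_nonneg z)
      (Complex.normSq_nonneg (aeval z (h N)))) (sq_nonneg z.im)
    linarith
  mul_derivative_neg x hx hx1 h0 := by
    have h1 := hh.energy_neg hx hx1.le N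
    rw [eval_derivative_sub_X_sq_mul]
    simp only [ha, one_mul, eval_sub, eval_mul, eval_pow, eval_X] at h1 h0 ⊢
    have h2 : (h (N + 1)).eval x = x ^ 2 * (h N).eval x := by linarith
    rw [h2] at h1 ⊢
    have h3 := mul_neg_of_pos_of_neg (sub_pos.2 hx1) h1
    have h4 : 0 ≤ (1 - x ^ 2) * (x * (h N).eval x) ^ 2 :=
      mul_nonneg (sub_nonneg.2 hx1.le) (sq_nonneg _)
    linarith

/-- To the right of the supports `W` does not change, while `S` picks up a factor `X ^ 2` in every
step. -/
theorem jost_add_nat (hh : J.IsJostPolynomial h) (hN : ∀ n, N ≤ n → J.a n = 1 ∧ J.b n = 0)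
    (k : ℕ) : h (N + k + 1) - X ^ 2 * h (N + k) = h (N + 1) - X ^ 2 * h N ∧
      h (N + k) - h (N + k + 1) = X ^ (2 * k) * (h N - h (N + 1)) := by
  induction k with
  | zero => simp
  | succ k ih =>
    have h1 := hh.recurrence (N + k + 1)
    rw [(hN (N + k + 1) (by omega)).1, (hN (N + k + 1) (by omega)).2,
      add_sub_cancel_right, (hN (N + k) (by omega)).1, C_1, C_0] at h1
    push_cast
    rw [← add_assoc]
    constructor
    · linear_combination ih.1 + h1
    · linear_combination X ^ 2 * ih.2 - h1

/-- Layer stripping: the Jost polynomials far to the right determine the coefficients, going down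
one index at a time. Two consecutive values at `0` give `a n`, the linear coefficient of the
recurrence gives `b n`, and the recurrence then gives `a (n - 1) * h (n - 1)`, whose value at `0` is
`a (n - 1) ^ 2 * h n 0`. -/
theorem coeff_eq_of_eventually_eq (hh : J.IsJostPolynomial h) (hh' : J'.IsJostPolynomial h')
    {j : ℤ} (H : ∀ n, N ≤ n → h' (n + j) = h n) (n : ℤ) :
    J'.a (n + j) = J.a n ∧ J'.b (n + j) = J.b n := by
  have hab : ∀ m, (∀ n, m ≤ n → h' (n + j) = h n) →
      J'.a (m + j) = J.a m ∧ J'.b (m + j) = J.b m := by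
    intro m hm
    have e0 := hm m le_rfl
    have e1 := hm (m + 1) (by omega)
    rw [add_right_comm] at e1
    have ha : J'.a (m + j) = J.a m := by
      have h1 := hh.coeff_zero_succ m
      have h2 := hh'.coeff_zero_succ (m + j)
      rw [e0, e1, ← h1] at h2
      exact mul_right_cancel₀ (hh.coeff_zero_pos _).ne' h2
    refine ⟨ha, ?_⟩
    have h1 := congrArg (fun p => (derivative p).eval 0) (hh.recurrence m)
    have h2 := congrArg (fun p => (derivative p).eval 0) (hh'.recurrence (m + j))
    rw [e0, e1, ha] at h2
    have h3 := (hh.coeff_zero_pos m).ne'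
    rw [coeff_zero_eq_eval_zero] at h3
    -- At `0` the derivative of the recurrence does not see the two terms with `X ^ 2`.
    simp at h1 h2
    apply mul_right_cancel₀ h3
    linarith
  have key : ∀ k : ℕ, ∀ n, N - k ≤ n → h' (n + j) = h n := by
    intro k
    induction k with
    | zero => simpa using H
    | succ k ih =>
      intro n hn
      rcases lt_or_ge n (N - k) with hlt | hge
      swap
      · exact ih n hge
      have ih1 : ∀ m, n + 1 ≤ m → h' (m + j) = h m := fun m hm => ih m (by push_cast at hn; omega)
      obtain ⟨ha, hb⟩ := hab _ ih1
      have h1 := hh.recurrence (n + 1)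
      have h2 := hh'.recurrence (n + j + 1)
      have e0 := ih1 (n + 1) le_rfl
      have e1 := ih1 (n + 1 + 1) (by omega)
      rw [show n + 1 + 1 + j = n + j + 1 + 1 by ring] at e1
      rw [add_right_comm] at e0 ha hb
      rw [e0, e1, ha, hb, add_sub_cancel_right] at h2
      rw [add_sub_cancel_right] at h1
      have h3 : C (J'.a (n + j)) * h' (n + j) = C (J.a n) * h n := by
        apply mul_left_cancel₀ (pow_ne_zero 2 (X_ne_zero (R := ℝ)))
        linear_combination h2 - h1
      have h4 : J'.a (n + j) = J.a n := by
        have c1 := hh.coeff_zero_succ n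
        have c2 := hh'.coeff_zero_succ (n + j)
        have c3 := congrArg (fun p => p.coeff 0) h3
        simp only [coeff_C_mul] at c3
        rw [← c1, ← c2, e0] at c3
        have c4 : J'.a (n + j) ^ 2 = J.a n ^ 2 := by
          apply mul_right_cancel₀ (hh.coeff_zero_pos (n + 1)).ne'
          linarith
        exact (pow_left_inj₀ (J'.a_pos _).le (J.a_pos _).le two_ne_zero).1 c4
      rw [h4] at h3
      exact mul_left_cancel₀ (C_ne_zero.2 (J.a_pos n).ne') h3
  refine hab n fun m hm => key (N - n).toNat m ?_
  have := Int.self_le_toNat (N - n)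
  omega

end JacobiCoeff.IsJostPolynomial

/-! ### Scattering data in terms of the Jost polynomials -/

theorem Polynomial.aeval_complex_ofReal (p : ℝ[X]) (x : ℝ) :
    aeval (x : ℂ) p = ((p.eval x : ℝ) : ℂ) :=
  aeval_ofReal p x

theorem Polynomial.analyticAt_aeval (p : ℝ[X]) (x : ℂ) : AnalyticAt ℂ (fun z : ℂ => aeval z p) x :=
  analyticAt_id.aeval_polynomial p

theorem Polynomial.meromorphicOrderAt_aeval {p : ℝ[X]} (hp : p ≠ 0) (x : ℂ) :
    meromorphicOrderAt (fun z : ℂ => aeval z p) x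
      = (((p.map (algebraMap ℝ ℂ)).rootMultiplicity x : ℤ) : WithTop ℤ) := by
  have hp' : p.map (algebraMap ℝ ℂ) ≠ 0 := by simpa using hp
  obtain ⟨q, hq, hq'⟩ := exists_eq_pow_rootMultiplicity_mul_and_not_dvd _ hp' x
  rw [meromorphicOrderAt_eq_int_iff (p.analyticAt_aeval x).meromorphicAt]
  refine ⟨fun z => q.eval z, analyticAt_id.aeval_polynomial q, fun h => hq' (dvd_iff_isRoot.2 h),
    Filter.Eventually.of_forall fun z => ?_⟩
  have : aeval z p = (p.map (algebraMap ℝ ℂ)).eval z := by simp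
  rw [this, zpow_natCast, smul_eq_mul]
  nth_rw 1 [hq]
  simp

namespace JacobiCoeff

theorem IsSolution.inv {J : JacobiCoeff} {z : ℂ} {f : ℤ → ℂ} (hf : J.IsSolution z⁻¹ f) :
    J.IsSolution z f := fun n => by
  rw [hf n, inv_inv, add_comm z]

/-- The threshold beyond which `f⁺(n, z) = z ^ n` does not depend on `z`. -/
theorem jostPlus_eq {J : JacobiCoeff} {N : ℤ} (hN : ∀ n, N ≤ n → J.a n = 1 ∧ J.b n = 0) {z : ℂ}
    (hz : z ≠ 0) {n : ℤ} (hn : N ≤ n) : J.jostPlus z n = z ^ n := by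
  obtain ⟨hf, M, hM⟩ := J.jostPlus_spec hz
  suffices H : ∀ k : ℕ, ∀ n, N ≤ n → M - k ≤ n → J.jostPlus z n = z ^ n from
    H (M - n).toNat n hn (by have := Int.self_le_toNat (M - n); omega)
  intro k
  induction k with
  | zero => exact fun n _ h => hM n (by simpa using h)
  | succ k ih =>
    intro n hn hk
    have h1 := hf (n + 1)
    unfold tau at h1
    rw [add_sub_cancel_right, (hN n hn).1, (hN (n + 1) (by omega)).1, (hN (n + 1) (by omega)).2,
      ih (n + 1) (by omega) (by push_cast at hk; omega),
      ih (n + 1 + 1) (by omega) (by push_cast at hk; omega),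
      zpow_add_one₀ hz, zpow_add_one₀ hz] at h1
    have hz' : z * z⁻¹ = 1 := mul_inv_cancel₀ hz
    push_cast at h1
    linear_combination h1 + z ^ n * hz'

theorem halfBoundStates_eq_image {J : JacobiCoeff} {W : ℝ[X]}
    (hW : ∀ z, z ≠ 0 → J.w z = aeval z W) :
    J.halfBoundStates = Complex.ofReal '' {e | e ^ 2 = 1 ∧ W.eval e = 0} := by
  ext z
  simp only [halfBoundStates, Set.mem_ofPred_eq, Set.mem_image]
  constructor
  · rintro ⟨rfl | rfl, h⟩
    · refine ⟨1, ⟨by norm_num, ?_⟩, by simp⟩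
      rw [hW _ (by norm_num), ← Complex.ofReal_one, aeval_complex_ofReal] at h
      exact_mod_cast h
    · refine ⟨-1, ⟨by norm_num, ?_⟩, by simp⟩
      rw [hW _ (by norm_num), ← Complex.ofReal_one, ← Complex.ofReal_neg, aeval_complex_ofReal] at h
      exact_mod_cast h
  · rintro ⟨e, ⟨he, h⟩, rfl⟩
    rcases sq_eq_one_iff.1 he with rfl | rfl
    · exact ⟨by simp, by rw [hW _ (by norm_num), aeval_complex_ofReal, h, Complex.ofReal_zero]⟩
    · exact ⟨by simp, by rw [hW _ (by norm_num), aeval_complex_ofReal, h, Complex.ofReal_zero]⟩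

namespace IsJostPolynomial

variable {J : JacobiCoeff} {h : ℤ → ℝ[X]} {N : ℤ} {z : ℂ}

theorem jostMinus_eq (hh : J.IsJostPolynomial h) (hz : z ≠ 0) (n : ℤ) :
    J.jostMinus z n = z ^ (-n) * aeval z (h n) := by
  have H : J.IsJostMinus z fun n => z ^ (-n) * aeval z (h n) := by
    refine ⟨fun n => ?_, ?_⟩
    · have h1 := hh.recurrence_aeval z n
      unfold tau
      dsimp only
      rw [show -(n - 1) = -n + 1 by ring, show -(n + 1) = -n - 1 by ring, zpow_add_one₀ hz,
        zpow_sub_one₀ hz]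
      have hz' : z * z⁻¹ = 1 := mul_inv_cancel₀ hz
      linear_combination z ^ (-n) * z⁻¹ * h1 + (z ^ (-n) * (z * aeval z (h n)
        - J.b n * aeval z (h n) - z * J.a (n - 1) * aeval z (h (n - 1)))) * hz'
    · obtain ⟨M, hM⟩ := hh.eventually_one
      exact ⟨M, fun n hn => by simp [hM n hn]⟩
  exact congrFun ((J.existsUnique_jostMinus hz).unique (J.jostMinus_spec hz) H) n

theorem w_eq (hh : J.IsJostPolynomial h) (hN : ∀ n, N ≤ n → J.a n = 1 ∧ J.b n = 0) (hz : z ≠ 0) :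
    J.w z = aeval z (h (N + 1) - X ^ 2 * h N) := by
  have hz' : z * z⁻¹ = 1 := mul_inv_cancel₀ hz
  have hzN : z ^ N * z ^ (-N) = 1 := by rw [← zpow_add₀ hz, add_neg_cancel, zpow_zero]
  unfold w
  rw [← J.wronskian_eq_zero_index (J.jostPlus_spec hz).1 (J.jostMinus_spec hz).1 N, wronskian,
    jostPlus_eq hN hz le_rfl, jostPlus_eq hN hz (Int.le_add_one le_rfl), hh.jostMinus_eq hz,
    hh.jostMinus_eq hz, (hN N le_rfl).1, neg_add, ← sub_eq_add_neg, zpow_sub_one₀ hz,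
    zpow_add_one₀ hz]
  simp only [map_sub, map_mul, map_pow, aeval_X, Complex.ofReal_one]
  linear_combination (z * z⁻¹ * aeval z (h (N + 1)) - z ^ 2 * aeval z (h N)) * hzN
    + aeval z (h (N + 1)) * hz'

theorem wronskian_jostMinus_jostPlus_inv (hh : J.IsJostPolynomial h)
    (hN : ∀ n, N ≤ n → J.a n = 1 ∧ J.b n = 0) (hz : z ≠ 0) :
    z * J.wronskian (J.jostMinus z) (J.jostPlus z⁻¹) 0
      = z ^ (-(2 * N)) * aeval z (h N - h (N + 1)) := by
  have hz' : z * z⁻¹ = 1 := mul_inv_cancel₀ hz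
  have hi := inv_ne_zero hz
  rw [← J.wronskian_eq_zero_index (J.jostMinus_spec hz).1 (J.jostPlus_spec hi).1.inv N, wronskian,
    jostPlus_eq hN hi le_rfl, jostPlus_eq hN hi (Int.le_add_one le_rfl), hh.jostMinus_eq hz,
    hh.jostMinus_eq hz, (hN N le_rfl).1, neg_add, ← sub_eq_add_neg, zpow_sub_one₀ hz,
    zpow_add_one₀ hi, show -(2 * N) = -N + -N by ring, zpow_add₀ hz, inv_zpow, ← zpow_neg]
  simp only [map_sub, Complex.ofReal_one]
  linear_combination (z ^ (-N) * z ^ (-N) * (aeval z (h N) - aeval z (h (N + 1)))) * hz'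

theorem reflectionPlus_eventuallyEq (hh : J.IsJostPolynomial h)
    (hN : ∀ n, N ≤ n → J.a n = 1 ∧ J.b n = 0) (x : ℂ) :
    J.reflectionPlus =ᶠ[nhdsWithin x {x}ᶜ] fun z => z ^ (-(2 * N)) *
      aeval z (h N - h (N + 1)) / aeval z (h (N + 1) - X ^ 2 * h N) := by
  -- The formula holds off `0, ±1`; the common factor `1 - z ^ 2` is zero at `±1`.
  have hfin : ({0, 1, -1} \ {x} : Set ℂ).Finite := Set.toFinite _
  have h1 : ∀ᶠ z in nhds x, z ∉ ({0, 1, -1} \ {x} : Set ℂ) :=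
    hfin.isClosed.isOpen_compl.mem_nhds (by simp)
  filter_upwards [h1.filter_mono nhdsWithin_le_nhds, self_mem_nhdsWithin] with z hz hzx
  simp only [Set.mem_sdiff, Set.mem_insert_iff, Set.mem_singleton_iff, not_and, not_not] at hz
  have hzx' : z ≠ x := hzx
  have hz3 : ¬ (z = 0 ∨ z = 1 ∨ z = -1) := fun h => hzx' (hz h)
  push Not at hz3
  obtain ⟨h0, hp, hm⟩ := hz3
  have hd : 1 - z ^ 2 ≠ 0 := fun h => by
    rcases sq_eq_one_iff.1 (by linear_combination -h : z ^ 2 = 1) with h | h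
    exacts [hp h, hm h]
  rw [reflectionPlus, betaPlus, alpha, hh.wronskian_jostMinus_jostPlus_inv hN h0,
    ← hh.w_eq hN h0, w, div_div_div_cancel_right₀ hd]

theorem w_ne_zero (hh : J.IsJostPolynomial h) (n : ℤ) :
    h (n + 1) - X ^ 2 * h n ≠ 0 := fun h0 => by
  have h1 := congrArg (fun p => p.coeff 0) h0
  have h2 := hh.coeff_zero_pos (n + 1)
  simp [coeff_X_pow] at h1
  exact h2.ne' h1

theorem meromorphicOrderAt_reflectionPlus (hh : J.IsJostPolynomial h)
    (hN : ∀ n, N ≤ n → J.a n = 1 ∧ J.b n = 0) (hS : h N - h (N + 1) ≠ 0) (x : ℂ) :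
    meromorphicOrderAt J.reflectionPlus x =
      (((if x = 0 then -(2 * N) else 0)
        + ((h N - h (N + 1)).map (algebraMap ℝ ℂ)).rootMultiplicity x
        - ((h (N + 1) - X ^ 2 * h N).map (algebraMap ℝ ℂ)).rootMultiplicity x : ℤ) :
          WithTop ℤ) := by
  have h1 : meromorphicOrderAt (fun z : ℂ => z ^ (-(2 * N))) x
      = ((if x = 0 then -(2 * N) else 0 : ℤ) : WithTop ℤ) := by
    split_ifs with hx
    · subst hx
      simpa using fun_meromorphicOrderAt_zpow_id_sub_const (𝕜 := ℂ) (x := 0) (n := -(2 * N))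
    · rw [meromorphicOrderAt_eq_int_iff (by fun_prop)]
      exact ⟨fun z => z ^ (-(2 * N)), analyticAt_id.zpow hx, zpow_ne_zero _ hx, by simp⟩
  have hz : MeromorphicAt (fun z : ℂ => z ^ (-(2 * N))) x := by fun_prop
  have hzS : MeromorphicAt (fun z : ℂ => z ^ (-(2 * N)) * aeval z (h N - h (N + 1))) x :=
    hz.mul (analyticAt_aeval _ x).meromorphicAt
  rw [meromorphicOrderAt_congr (hh.reflectionPlus_eventuallyEq hN x),
    fun_meromorphicOrderAt_div hzS (analyticAt_aeval _ x).meromorphicAt,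
    fun_meromorphicOrderAt_mul hz (analyticAt_aeval _ x).meromorphicAt,
    meromorphicOrderAt_aeval hS, meromorphicOrderAt_aeval (hh.w_ne_zero N), h1]
  norm_cast

theorem meromorphicOrderAt_reflectionPlus_eq_top_iff (hh : J.IsJostPolynomial h)
    (hN : ∀ n, N ≤ n → J.a n = 1 ∧ J.b n = 0) (x : ℂ) :
    meromorphicOrderAt J.reflectionPlus x = ⊤ ↔ h N - h (N + 1) = 0 := by
  constructor
  · intro h0
    by_contra hS
    rw [hh.meromorphicOrderAt_reflectionPlus hN hS] at h0
    exact WithTop.coe_ne_top h0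
  · intro hS
    rw [meromorphicOrderAt_congr (hh.reflectionPlus_eventuallyEq hN x), hS]
    simp [meromorphicOrderAt_eq_top_iff]

end IsJostPolynomial
end JacobiCoeff

/-! ### Consequences of unitarity -/

/-- Real polynomials with the same complex roots, counted with multiplicity, are proportional. -/
theorem Polynomial.exists_eq_C_mul_of_rootMultiplicity_eq {p q : ℝ[X]} (hp : p ≠ 0) (hq : q ≠ 0)
    (H : ∀ z : ℂ, (p.map (algebraMap ℝ ℂ)).rootMultiplicity z
      = (q.map (algebraMap ℝ ℂ)).rootMultiplicity z) :
    ∃ c : ℝ, c ≠ 0 ∧ p = C c * q := by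
  have hp' : p.map (algebraMap ℝ ℂ) ≠ 0 := by simpa using hp
  have hq' : q.map (algebraMap ℝ ℂ) ≠ 0 := by simpa using hq
  have h1 : (p.map (algebraMap ℝ ℂ)).roots = (q.map (algebraMap ℝ ℂ)).roots := by
    ext z
    rw [count_roots, count_roots, H]
  have h2 := (IsAlgClosed.associated_iff_roots_eq_roots hp' hq').2 h1
  obtain ⟨u, hu⟩ := associated_of_dvd_dvd ((map_dvd_map' _).1 h2.symm.dvd)
    ((map_dvd_map' _).1 h2.dvd)
  obtain ⟨c, hc, hcu⟩ := Polynomial.isUnit_iff.1 u.isUnit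
  exact ⟨c, hc.ne_zero, by rw [← hu, ← hcu, mul_comm]⟩

/-- A continuous inequality on the unit circle without `±1` extends to the whole circle. -/
theorem le_of_forall_norm_eq_one_of_sq_ne_one {f g : ℂ → ℝ} (hf : Continuous f) (hg : Continuous g)
    (H : ∀ z : ℂ, ‖z‖ = 1 → z ^ 2 ≠ 1 → f z ≤ g z) {z : ℂ} (hz : ‖z‖ = 1) : f z ≤ g z := by
  by_cases hz1 : z ^ 2 = 1
  swap
  · exact H z hz hz1
  have hne : ∀ t : ℝ, (1 - t * Complex.I) ≠ 0 := fun t h => by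
    simpa using congrArg Complex.re h
  -- Cayley parametrization of the circle; `φ t ^ 2 = 1` only for `t = 0`.
  let φ : ℝ → ℂ := fun t => z * ((1 + t * Complex.I) / (1 - t * Complex.I))
  have hφ : Continuous φ := by
    refine continuous_const.mul (Continuous.div (by fun_prop) (by fun_prop) hne)
  have hφ0 : φ 0 = z := by simp [φ]
  have h1 : ∀ t, ‖φ t‖ = 1 := fun t => by
    have : (1 + t * Complex.I) = (starRingEnd ℂ) (1 - t * Complex.I) := by simp
    rw [norm_mul, hz, norm_div, this, Complex.norm_conj, div_self (norm_ne_zero_iff.2 (hne t)),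
      one_mul]
  have h2 : ∀ t, t ≠ 0 → φ t ^ 2 ≠ 1 := fun t ht h => by
    simp only [φ] at h
    rw [mul_pow, hz1, one_mul, div_pow, div_eq_one_iff_eq (pow_ne_zero 2 (hne t))] at h
    have h3 : (4 * t : ℂ) * Complex.I = 0 := by linear_combination h
    simp [Complex.I_ne_zero, ht] at h3
  have hf' := (hf.comp hφ).tendsto 0
  have hg' := (hg.comp hφ).tendsto 0
  simp only [Function.comp_apply, hφ0] at hf' hg'
  refine le_of_tendsto_of_tendsto (hf'.mono_left (nhdsWithin_le_nhds (s := {0}ᶜ)))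
    (hg'.mono_left (nhdsWithin_le_nhds (s := {0}ᶜ))) ?_
  filter_upwards [self_mem_nhdsWithin] with t ht
  exact H _ (h1 t) (h2 t ht)

namespace IsScatteringPair

variable {W S W' S' : ℝ[X]}

theorem ne_zero (P : IsScatteringPair W S) : W ≠ 0 := by
  rintro rfl
  simpa using P.coeff_zero_pos

theorem one_sub_sq_mul_ne_zero {z : ℂ} (hz : z ^ 2 ≠ 1) : (1 - z ^ 2) * (1 - z⁻¹ ^ 2) ≠ 0 :=
  mul_ne_zero (sub_ne_zero.2 hz.symm)
    (sub_ne_zero.2 fun h => hz (by rw [inv_pow] at h; exact inv_eq_one.1 h.symm))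

theorem sq_ne_one_of_norm_lt_one {z : ℂ} (hz : ‖z‖ < 1) : z ^ 2 ≠ 1 := fun h => by
  have := congrArg norm h
  rw [norm_pow, norm_one] at this
  exact (pow_lt_one₀ (norm_nonneg z) hz two_ne_zero).ne this

/-- Unitarity on the unit circle, where `z⁻¹` is the conjugate of `z`. -/
theorem sq_norm_sub_sq_norm (P : IsScatteringPair W S) {z : ℂ} (hz : ‖z‖ = 1) :
    ‖aeval z W‖ ^ 2 - ‖aeval z S‖ ^ 2 = ‖1 - z ^ 2‖ ^ 2 := by
  have hz0 : z ≠ 0 := norm_ne_zero_iff.1 (by rw [hz]; exact one_ne_zero)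
  have h1 := P.unitarity z hz0
  have h2 : z⁻¹ = (starRingEnd ℂ) z := by
    rw [Complex.inv_def, Complex.normSq_eq_norm_sq, hz]; simp
  rw [h2, aeval_conj, aeval_conj, Complex.mul_conj', Complex.mul_conj'] at h1
  have h3 : 1 - (starRingEnd ℂ) z ^ 2 = (starRingEnd ℂ) (1 - z ^ 2) := by simp
  rw [h3, Complex.mul_conj'] at h1
  exact_mod_cast h1

theorem aeval_ne_zero (P : IsScatteringPair W S) {z : ℂ} (hz : ‖z‖ = 1) (hz1 : z ^ 2 ≠ 1) :
    aeval z W ≠ 0 := fun h0 => by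
  have h1 := P.sq_norm_sub_sq_norm hz
  have h2 : 0 < ‖1 - z ^ 2‖ := norm_pos_iff.2 (sub_ne_zero.2 hz1.symm)
  rw [h0, norm_zero] at h1
  have h3 := pow_pos h2 2
  nlinarith [sq_nonneg ‖aeval z S‖]

theorem norm_le (P : IsScatteringPair W S) {z : ℂ} (hz : ‖z‖ = 1) :
    ‖aeval z S‖ ≤ ‖aeval z W‖ := by
  have h1 := P.sq_norm_sub_sq_norm hz
  refine (pow_le_pow_iff_left₀ (norm_nonneg _) (norm_nonneg _) two_ne_zero).1 ?_
  linarith [sq_nonneg ‖1 - z ^ 2‖]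

theorem norm_ofReal_of_sq_eq_one {e : ℝ} (he : e ^ 2 = 1) : ‖(e : ℂ)‖ = 1 := by
  rw [Complex.norm_real, Real.norm_eq_abs]
  rcases sq_eq_one_iff.1 he with rfl | rfl <;> simp

/-- At a point `±1` that is not a half-bound state the reflection coefficient has modulus one,
and it has modulus at most one on the whole circle; so a constant ratio of moduli is at most
one. -/
theorem abs_le_one_of_eval_ne_zero (P : IsScatteringPair W S) (P' : IsScatteringPair W' S')
    {c : ℝ} (H : ∀ z : ℂ, ‖z‖ = 1 →
      ‖aeval z S'‖ * ‖aeval z W‖ = |c| * (‖aeval z S‖ * ‖aeval z W'‖))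
    {e : ℝ} (he : e ^ 2 = 1) (hW : W.eval e ≠ 0) : |c| ≤ 1 := by
  have h1 := le_of_forall_norm_eq_one_of_sq_ne_one (f := fun z => |c| * ‖aeval z S‖)
    (g := fun z => ‖aeval z W‖) (by fun_prop) (by fun_prop) (fun z hz hz1 => ?_)
    (norm_ofReal_of_sq_eq_one he)
  · simp only [aeval_complex_ofReal, P.eval_of_sq_eq_one e he, Complex.norm_real, norm_neg] at h1
    have h2 : 0 < ‖W.eval e‖ := norm_pos_iff.2 hW
    exact le_of_mul_le_mul_right (by linarith) h2
  · have h2 := H z hz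
    have h3 : 0 < ‖aeval z W'‖ := norm_pos_iff.2 (P'.aeval_ne_zero hz hz1)
    refine le_of_mul_le_mul_right ?_ h3
    have h4 := mul_le_mul_of_nonneg_right (P'.norm_le hz) (norm_nonneg (aeval z W))
    linarith

/-- If the quotients `S / W` and `S' / W'` have the same modulus on the unit circle, then so do the
denominators, by unitarity. -/
theorem norm_eq (P : IsScatteringPair W S) (P' : IsScatteringPair W' S')
    (H : ∀ z : ℂ, ‖z‖ = 1 → ‖aeval z S'‖ * ‖aeval z W‖ = ‖aeval z S‖ * ‖aeval z W'‖)
    {z : ℂ} (hz : ‖z‖ = 1) : ‖aeval z W‖ = ‖aeval z W'‖ := by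
  have key : ∀ z : ℂ, ‖z‖ = 1 → z ^ 2 ≠ 1 → ‖aeval z W‖ = ‖aeval z W'‖ := by
    intro z hz hz1
    have h1 := P.sq_norm_sub_sq_norm hz
    have h2 := P'.sq_norm_sub_sq_norm hz
    have h3 := congrArg (· ^ 2) (H z hz)
    have h4 : 0 < ‖1 - z ^ 2‖ := norm_pos_iff.2 (sub_ne_zero.2 hz1.symm)
    simp only [mul_pow] at h3
    refine (pow_left_inj₀ (norm_nonneg _) (norm_nonneg _) two_ne_zero).1 ?_
    apply mul_left_cancel₀ (pow_pos h4 2).ne'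
    linear_combination -‖aeval z W‖ ^ 2 * h2 + ‖aeval z W'‖ ^ 2 * h1 - h3
  exact le_antisymm
    (le_of_forall_norm_eq_one_of_sq_ne_one (f := fun z => ‖aeval z W‖)
      (g := fun z => ‖aeval z W'‖) (by fun_prop) (by fun_prop)
      (fun z hz hz1 => (key z hz hz1).le) hz)
    (le_of_forall_norm_eq_one_of_sq_ne_one (f := fun z => ‖aeval z W'‖)
      (g := fun z => ‖aeval z W‖) (by fun_prop) (by fun_prop)
      (fun z hz hz1 => (key z hz hz1).ge) hz)

theorem rootMultiplicity_zero (P : IsScatteringPair W S) :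
    (W.map (algebraMap ℝ ℂ)).rootMultiplicity 0 = 0 := by
  refine rootMultiplicity_eq_zero fun h => P.coeff_zero_pos.ne' ?_
  rw [IsRoot, ← coeff_zero_eq_eval_zero, coeff_map] at h
  simpa using h

theorem rootMultiplicity_of_sq_eq_one (P : IsScatteringPair W S) {e : ℝ} (he : e ^ 2 = 1) :
    (W.map (algebraMap ℝ ℂ)).rootMultiplicity (e : ℂ) = if W.eval e = 0 then 1 else 0 := by
  have h1 := eq_rootMultiplicity_map (p := W) (algebraMap ℝ ℂ).injective e
  rw [Complex.coe_algebraMap] at h1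
  rw [← h1]
  split_ifs with h0
  · refine le_antisymm (not_lt.1 fun h => ?_) ((rootMultiplicity_pos P.ne_zero).2 h0)
    exact P.derivative_ne_zero e he h0 ((one_lt_rootMultiplicity_iff_isRoot P.ne_zero).1 h).2
  · exact Polynomial.rootMultiplicity_eq_zero h0

/-- Cancellation in `S / W` can only occur at `±1`. -/
theorem rootMultiplicity_eq_zero_or (P : IsScatteringPair W S) {z : ℂ} (hz : z ≠ 0)
    (hz1 : z ^ 2 ≠ 1) : (W.map (algebraMap ℝ ℂ)).rootMultiplicity z = 0 ∨
      (S.map (algebraMap ℝ ℂ)).rootMultiplicity z = 0 := by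
  by_contra! h
  have h1 : ∀ p : ℝ[X], (p.map (algebraMap ℝ ℂ)).rootMultiplicity z ≠ 0 → aeval z p = 0 :=
    fun p hp => by
      by_contra h0
      exact hp (Polynomial.rootMultiplicity_eq_zero (by simpa [IsRoot] using h0))
  have h2 := P.unitarity z hz
  rw [h1 W h.1, h1 S h.2] at h2
  exact one_sub_sq_mul_ne_zero hz1 (by simpa using h2.symm)

/-- The denominators agree up to a positive constant as soon as the quotients have the same zeros
and poles and the same half-bound states. -/
theorem exists_pos_eq_C_mul (P : IsScatteringPair W S) (P' : IsScatteringPair W' S')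
    (H : ∀ z : ℂ, z ≠ 0 → (S'.map (algebraMap ℝ ℂ)).rootMultiplicity z
        + (W.map (algebraMap ℝ ℂ)).rootMultiplicity z
      = (S.map (algebraMap ℝ ℂ)).rootMultiplicity z
        + (W'.map (algebraMap ℝ ℂ)).rootMultiplicity z)
    (hstates : ∀ e : ℝ, e ^ 2 = 1 → (W.eval e = 0 ↔ W'.eval e = 0)) :
    ∃ t : ℝ, 0 < t ∧ W' = C t * W := by
  obtain ⟨t, -, ht⟩ := exists_eq_C_mul_of_rootMultiplicity_eq P'.ne_zero P.ne_zero fun z => by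
    by_cases hz : z = 0
    · rw [hz, P.rootMultiplicity_zero, P'.rootMultiplicity_zero]
    by_cases hz1 : z ^ 2 = 1
    · obtain ⟨e, he, rfl⟩ : ∃ e : ℝ, e ^ 2 = 1 ∧ (e : ℂ) = z := by
        rcases sq_eq_one_iff.1 hz1 with rfl | rfl
        exacts [⟨1, by norm_num, by simp⟩, ⟨-1, by norm_num, by simp⟩]
      rw [P.rootMultiplicity_of_sq_eq_one he, P'.rootMultiplicity_of_sq_eq_one he]
      simp only [hstates e he]
    · have := H z hz
      have := P.rootMultiplicity_eq_zero_or hz hz1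
      have := P'.rootMultiplicity_eq_zero_or hz hz1
      omega
  refine ⟨t, ?_, ht⟩
  have h1 := P'.coeff_zero_pos
  rw [ht, coeff_C_mul] at h1
  exact (pos_iff_pos_of_mul_pos h1).2 P.coeff_zero_pos

/-- If `S / W` and `S' / W'` have the same zeros and poles off the origin, they agree up to a real
constant and a power of `X`, given by the orders of `S` and `S'` at the origin. -/
theorem exists_X_pow_mul_eq (P : IsScatteringPair W S) (P' : IsScatteringPair W' S')
    (hS : S ≠ 0) (hS' : S' ≠ 0)
    (H : ∀ z : ℂ, z ≠ 0 → (S'.map (algebraMap ℝ ℂ)).rootMultiplicity z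
        + (W.map (algebraMap ℝ ℂ)).rootMultiplicity z
      = (S.map (algebraMap ℝ ℂ)).rootMultiplicity z
        + (W'.map (algebraMap ℝ ℂ)).rootMultiplicity z) :
    ∃ c : ℝ, c ≠ 0 ∧ X ^ (S.map (algebraMap ℝ ℂ)).rootMultiplicity 0 * (S' * W)
      = C c * (X ^ (S'.map (algebraMap ℝ ℂ)).rootMultiplicity 0 * (S * W')) := by
  have hX : (X : ℝ[X]) ≠ 0 := X_ne_zero
  have hmap : ∀ p : ℝ[X], p ≠ 0 → p.map (algebraMap ℝ ℂ) ≠ 0 := fun p hp => by simpa using hp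
  have hmul : ∀ (n : ℕ) (p q : ℝ[X]) (z : ℂ), p ≠ 0 → q ≠ 0 →
      ((X ^ n * (p * q)).map (algebraMap ℝ ℂ)).rootMultiplicity z
        = (if z = 0 then n else 0) + ((p.map (algebraMap ℝ ℂ)).rootMultiplicity z
          + (q.map (algebraMap ℝ ℂ)).rootMultiplicity z) := by
    intro n p q z hp hq
    rw [Polynomial.map_mul, rootMultiplicity_mul, Polynomial.map_mul, rootMultiplicity_mul,
      Polynomial.map_pow, map_X]
    · congr 1
      split_ifs with hz
      · have := rootMultiplicity_X_sub_C_pow (R := ℂ) 0 n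
        simpa [hz] using this
      · exact Polynomial.rootMultiplicity_eq_zero (by simp [IsRoot, hz])
    · exact mul_ne_zero (hmap p hp) (hmap q hq)
    · rw [← Polynomial.map_mul]
      exact hmap _ (mul_ne_zero (pow_ne_zero _ hX) (mul_ne_zero hp hq))
  refine exists_eq_C_mul_of_rootMultiplicity_eq
    (mul_ne_zero (pow_ne_zero _ hX) (mul_ne_zero hS' P.ne_zero))
    (mul_ne_zero (pow_ne_zero _ hX) (mul_ne_zero hS P'.ne_zero)) fun z => ?_
  rw [hmul _ _ _ _ hS' P.ne_zero, hmul _ _ _ _ hS P'.ne_zero]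
  split_ifs with hz
  · rw [hz, P.rootMultiplicity_zero, P'.rootMultiplicity_zero]
    omega
  · rw [H z hz]

end IsScatteringPair

/-! ### A scattering pair is determined by its zeros and poles -/

namespace IsScatteringPair

variable {W S W' S' : ℝ[X]}

/-- The powers of `X` cancel because the two sides are evaluated at `z` and at `z⁻¹`. -/
theorem aeval_mul_aeval_inv_of_X_pow_mul_eq {m l : ℕ} {d : ℝ}
    (h : X ^ m * S' = C d * (X ^ l * S)) {z : ℂ} (hz : z ≠ 0) :
    aeval z S' * aeval z⁻¹ S' = d ^ 2 * (aeval z S * aeval z⁻¹ S) := by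
  have h1 := congrArg (aeval z) h
  have h2 := congrArg (aeval z⁻¹) h
  simp only [map_mul, map_pow, aeval_X, aeval_C, Complex.coe_algebraMap] at h1 h2
  have hm : z ^ m * z⁻¹ ^ m = 1 := by rw [← mul_pow, mul_inv_cancel₀ hz, one_pow]
  have hl : z ^ l * z⁻¹ ^ l = 1 := by rw [← mul_pow, mul_inv_cancel₀ hz, one_pow]
  calc aeval z S' * aeval z⁻¹ S'
      = (z ^ m * aeval z S') * (z⁻¹ ^ m * aeval z⁻¹ S') := by
        linear_combination -(aeval z S' * aeval z⁻¹ S') * hm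
    _ = d ^ 2 * (aeval z S * aeval z⁻¹ S) := by
        rw [h1, h2]
        linear_combination d ^ 2 * (aeval z S * aeval z⁻¹ S) * hl

theorem eq_one_of_C_mul (P : IsScatteringPair W S) {t : ℝ} (ht : 0 < t)
    (h : ‖aeval Complex.I (C t * W)‖ = ‖aeval Complex.I W‖) : t = 1 := by
  have h1 := P.aeval_ne_zero Complex.norm_I (by rw [Complex.I_sq]; norm_num)
  rw [map_mul, aeval_C, norm_mul, Complex.coe_algebraMap, Complex.norm_real, Real.norm_eq_abs,
    abs_of_pos ht] at h
  exact mul_right_cancel₀ (norm_ne_zero_iff.2 h1) (h.trans (one_mul _).symm)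

/-- Zeros and poles determine `W`, and determine `S` up to sign and a power of `X`. If neither pair
has two half-bound states, the constant is fixed by `|R(±1)| = 1` at a point that is not a
half-bound state; if both have two, it is fixed by unitarity at an eigenvalue. -/
theorem eq_and_exists_sq_eq_one (P : IsScatteringPair W S) (P' : IsScatteringPair W' S')
    (hS : S ≠ 0) (hS' : S' ≠ 0)
    (H : ∀ z : ℂ, z ≠ 0 → (S'.map (algebraMap ℝ ℂ)).rootMultiplicity z
        + (W.map (algebraMap ℝ ℂ)).rootMultiplicity z
      = (S.map (algebraMap ℝ ℂ)).rootMultiplicity z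
        + (W'.map (algebraMap ℝ ℂ)).rootMultiplicity z)
    (hstates : ((∃ e : ℝ, e ^ 2 = 1 ∧ W.eval e ≠ 0) ∧ ∃ e : ℝ, e ^ 2 = 1 ∧ W'.eval e ≠ 0) ∨
      ((∀ e : ℝ, e ^ 2 = 1 → W.eval e = 0) ∧ (∀ e : ℝ, e ^ 2 = 1 → W'.eval e = 0) ∧
        ∃ z : ℂ, z ≠ 0 ∧ ‖z‖ < 1 ∧ aeval z W = 0)) :
    W' = W ∧ ∃ d : ℝ, d ^ 2 = 1 ∧ X ^ (S.map (algebraMap ℝ ℂ)).rootMultiplicity 0 * S'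
      = C d * (X ^ (S'.map (algebraMap ℝ ℂ)).rootMultiplicity 0 * S) := by
  obtain ⟨c, hc0, hc⟩ := P.exists_X_pow_mul_eq P' hS hS' H
  have hdiv : ∀ t : ℝ, W' = C t * W → X ^ (S.map (algebraMap ℝ ℂ)).rootMultiplicity 0 * S'
      = C (c * t) * (X ^ (S'.map (algebraMap ℝ ℂ)).rootMultiplicity 0 * S) := by
    intro t ht
    apply mul_right_cancel₀ P.ne_zero
    rw [ht] at hc
    rw [C_mul]
    linear_combination hc
  have hnorm : ∀ z : ℂ, ‖z‖ = 1 →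
      ‖aeval z S'‖ * ‖aeval z W‖ = |c| * (‖aeval z S‖ * ‖aeval z W'‖) := by
    intro z hz
    have h1 := congrArg (fun p => ‖aeval z p‖) hc
    simpa [hz, norm_mul, norm_pow] using h1
  rcases hstates with ⟨⟨e, he, hW⟩, e', he', hW'⟩ | ⟨hW, hW', z, hz0, hz1, hz⟩
  · have hc1 : |c| ≤ 1 := P.abs_le_one_of_eval_ne_zero P' hnorm he hW
    have hc2 : |c⁻¹| ≤ 1 := by
      refine P'.abs_le_one_of_eval_ne_zero P (fun z hz => ?_) he' hW'
      rw [hnorm z hz, abs_inv, ← mul_assoc, inv_mul_cancel₀ (abs_ne_zero.2 hc0), one_mul]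
    have hc3 : |c| = 1 := by
      refine le_antisymm hc1 ?_
      rw [abs_inv] at hc2
      exact (inv_le_one₀ (abs_pos.2 hc0)).1 hc2
    have hWW : ∀ z : ℂ, ‖z‖ = 1 → ‖aeval z W‖ = ‖aeval z W'‖ := fun z hz =>
      P.norm_eq P' (fun z hz => by rw [hnorm z hz, hc3, one_mul]) hz
    obtain ⟨t, ht0, ht⟩ := P.exists_pos_eq_C_mul P' H fun e he => by
      have := hWW e (norm_ofReal_of_sq_eq_one he)
      rw [aeval_complex_ofReal, aeval_complex_ofReal, Complex.norm_real, Complex.norm_real] at this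
      rw [← norm_eq_zero, this, norm_eq_zero]
    obtain rfl := P.eq_one_of_C_mul ht0 (by rw [← ht, hWW _ Complex.norm_I])
    exact ⟨by simpa using ht, c * 1, by rw [mul_one, ← sq_abs, hc3, one_pow], hdiv 1 ht⟩
  · obtain ⟨t, ht0, ht⟩ := P.exists_pos_eq_C_mul P' H fun e he => iff_of_true (hW e he) (hW' e he)
    have hd := hdiv t ht
    -- Subtracting the unitarity relations of the two pairs. At the eigenvalue the left side
    -- vanishes while `S z * S z⁻¹` does not, so `c * t = ±1`; then `t = 1` from a point where
    -- `W` is nonzero.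
    have key : ∀ z : ℂ, z ≠ 0 → (t ^ 2 - 1 : ℂ) * (aeval z W * aeval z⁻¹ W)
        = (((c * t : ℝ) : ℂ) ^ 2 - 1) * (aeval z S * aeval z⁻¹ S) := by
      intro z hz
      have h1 := P.unitarity z hz
      have h2 := P'.unitarity z hz
      rw [aeval_mul_aeval_inv_of_X_pow_mul_eq hd hz, ht, map_mul, map_mul, aeval_C, aeval_C,
        Complex.coe_algebraMap] at h2
      linear_combination h2 - h1
    have hz2 : z ^ 2 ≠ 1 := sq_ne_one_of_norm_lt_one hz1
    have hSz : aeval z S * aeval z⁻¹ S ≠ 0 := by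
      have h1 := P.unitarity z hz0
      rw [hz, zero_mul, zero_sub] at h1
      exact neg_ne_zero.1 (h1 ▸ one_sub_sq_mul_ne_zero hz2)
    have hd1 : (c * t) ^ 2 = 1 := by
      have h1 := key z hz0
      rw [hz, zero_mul, mul_zero, eq_comm, mul_eq_zero, or_iff_left hSz, sub_eq_zero] at h1
      exact_mod_cast h1
    have ht1 : t = 1 := by
      have h1 := key Complex.I Complex.I_ne_zero
      rw [← Complex.ofReal_pow (c * t), hd1, Complex.ofReal_one, sub_self, zero_mul,
        mul_eq_zero] at h1
      have h2 : aeval Complex.I W ≠ 0 :=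
        P.aeval_ne_zero Complex.norm_I (by rw [Complex.I_sq]; norm_num)
      have h3 : aeval Complex.I⁻¹ W ≠ 0 :=
        P.aeval_ne_zero (by simp) (by rw [inv_pow, Complex.I_sq]; norm_num)
      rw [or_iff_left (mul_ne_zero h2 h3), sub_eq_zero] at h1
      have h4 : t ^ 2 = 1 := by exact_mod_cast h1
      exact (pow_eq_one_iff_of_nonneg ht0.le two_ne_zero).1 h4
    subst ht1
    exact ⟨by simpa using ht, _, hd1, hd⟩

/-- Sign and parity are determined too. At a point `±1` that is not a half-bound state
`S = -W` fixes the sign; without half-bound states the two points `±1` together also fix the parity.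
With two half-bound states the sign of `x * S x * W' x` at an eigenvalue `x` decides. -/
theorem eq_and_X_pow_mul_eq (P : IsScatteringPair W S) (P' : IsScatteringPair W' S')
    (hS : S ≠ 0) (hS' : S' ≠ 0)
    (H : ∀ z : ℂ, z ≠ 0 → (S'.map (algebraMap ℝ ℂ)).rootMultiplicity z
        + (W.map (algebraMap ℝ ℂ)).rootMultiplicity z
      = (S.map (algebraMap ℝ ℂ)).rootMultiplicity z
        + (W'.map (algebraMap ℝ ℂ)).rootMultiplicity z)
    (hstates : ((∃ e : ℝ, e ^ 2 = 1 ∧ W.eval e ≠ 0) ∧ ∃ e : ℝ, e ^ 2 = 1 ∧ W'.eval e ≠ 0) ∨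
      ((∀ e : ℝ, e ^ 2 = 1 → W.eval e = 0) ∧ (∀ e : ℝ, e ^ 2 = 1 → W'.eval e = 0) ∧
        ∃ z : ℂ, z ≠ 0 ∧ ‖z‖ < 1 ∧ aeval z W = 0))
    (hparity : (∃ e : ℝ, e ^ 2 = 1 ∧ W.eval e = 0) →
      Even ((S.map (algebraMap ℝ ℂ)).rootMultiplicity 0
        + (S'.map (algebraMap ℝ ℂ)).rootMultiplicity 0)) :
    W' = W ∧ X ^ (S.map (algebraMap ℝ ℂ)).rootMultiplicity 0 * S'
        = X ^ (S'.map (algebraMap ℝ ℂ)).rootMultiplicity 0 * S ∧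
      Even ((S.map (algebraMap ℝ ℂ)).rootMultiplicity 0
        + (S'.map (algebraMap ℝ ℂ)).rootMultiplicity 0) := by
  obtain ⟨hWW, d, hd1, hd⟩ := P.eq_and_exists_sq_eq_one P' hS hS' H hstates
  subst hWW
  generalize (S.map (algebraMap ℝ ℂ)).rootMultiplicity 0 = m at *
  generalize (S'.map (algebraMap ℝ ℂ)).rootMultiplicity 0 = l at *
  have hev : ∀ e : ℝ, e ^ 2 = 1 → W'.eval e ≠ 0 → e ^ m = d * e ^ l := by
    intro e he hW
    have h1 := congrArg (eval e) hd
    simp only [eval_mul, eval_pow, eval_X, eval_C, P.eval_of_sq_eq_one e he,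
      P'.eval_of_sq_eq_one e he] at h1
    apply mul_right_cancel₀ hW
    linear_combination -h1
  suffices hcl : d = 1 ∧ Even (m + l) by
    obtain ⟨rfl, h⟩ := hcl
    exact ⟨rfl, by simpa using hd, h⟩
  by_cases hex : ∃ e : ℝ, e ^ 2 = 1 ∧ W'.eval e = 0
  · have hml := hparity hex
    refine ⟨?_, hml⟩
    have hx : ∀ x : ℝ, x ≠ 0 → 0 < x ^ m * x ^ l := fun x hx => by
      rw [← pow_add]
      exact hml.pow_pos hx
    rcases hstates with ⟨⟨e, he, hW⟩, -⟩ | ⟨-, -, z, hz0, hz1, hz⟩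
    · have h1 := hev e he hW
      have he0 : e ≠ 0 := by rintro rfl; norm_num at he
      have h2 := hx e he0
      rw [h1] at h2
      rcases sq_eq_one_iff.1 hd1 with h | h
      · exact h
      · rw [h] at h2
        nlinarith [mul_self_nonneg (e ^ l)]
    · obtain ⟨x, rfl⟩ : ∃ x : ℝ, (x : ℂ) = z :=
        ⟨z.re, Complex.ext (by simp) (by simp [P.im_eq_zero z hz0 hz1 hz])⟩
      have hx0 : x ≠ 0 := by simpa using hz0
      have hx1 : x ^ 2 < 1 := by
        rw [Complex.norm_real, Real.norm_eq_abs] at hz1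
        rwa [sq_lt_one_iff_abs_lt_one]
      have hW : W'.eval x = 0 := by
        rw [aeval_complex_ofReal] at hz
        exact_mod_cast hz
      have h1 := P.mul_derivative_neg x hx0 hx1 hW
      have h2 := P'.mul_derivative_neg x hx0 hx1 hW
      rcases sq_eq_one_iff.1 hd1 with h | h
      · exact h
      · exfalso
        -- With `d = -1` the values `S x` and `S' x` would have opposite signs.
        have h3 := congrArg (eval x) hd
        simp only [eval_mul, eval_pow, eval_X, eval_C, h] at h3
        have h4 := mul_pos_of_neg_of_neg h1 h2
        have h5 := mul_pos (hx x hx0) h4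
        have h6 : x ^ m * x ^ l * (x * S.eval x * (derivative W').eval x *
            (x * S'.eval x * (derivative W').eval x))
            = -(x * x ^ l * S.eval x * (derivative W').eval x) ^ 2 := by
          linear_combination (x ^ l * x ^ 2 * S.eval x * (derivative W').eval x ^ 2) * h3
        rw [h6] at h5
        linarith [sq_nonneg (x * x ^ l * S.eval x * (derivative W').eval x)]
  · push Not at hex
    have h1 := hev 1 (by norm_num) (hex 1 (by norm_num))
    have h2 := hev (-1) (by norm_num) (hex (-1) (by norm_num))
    simp only [one_pow, mul_one] at h1
    refine ⟨h1.symm, ?_⟩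
    rw [← h1, one_mul] at h2
    rw [← neg_one_pow_eq_one_iff_even (R := ℝ) (by norm_num), pow_add, h2, ← pow_add, ← two_mul,
      pow_mul]
    norm_num

/-- A vanishing reflection coefficient forces two half-bound states and no eigenvalues. -/
theorem ne_zero_of_exists (P : IsScatteringPair W S)
    (hstates : (∃ e : ℝ, e ^ 2 = 1 ∧ W.eval e ≠ 0) ∨
      ∃ z : ℂ, z ≠ 0 ∧ ‖z‖ < 1 ∧ aeval z W = 0) : S ≠ 0 := by
  rintro rfl
  rcases hstates with ⟨e, he, hW⟩ | ⟨z, hz0, hz1, hz⟩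
  · have := P.eval_of_sq_eq_one e he
    rw [eval_zero, eq_comm, neg_eq_zero] at this
    exact hW this
  · have hz2 : z ^ 2 ≠ 1 := sq_ne_one_of_norm_lt_one hz1
    have h1 := P.unitarity z hz0
    rw [hz] at h1
    exact one_sub_sq_mul_ne_zero hz2 (by simpa using h1.symm)

end IsScatteringPair

/-! ### The uniqueness theorem for the right reflection coefficient -/

namespace JacobiCoeff

theorem halfBoundStates_subsingleton_iff {J : JacobiCoeff} {W : ℝ[X]}
    (hW : ∀ z, z ≠ 0 → J.w z = aeval z W) :
    J.halfBoundStates.Subsingleton ↔ ∃ e : ℝ, e ^ 2 = 1 ∧ W.eval e ≠ 0 := by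
  rw [halfBoundStates_eq_image hW, Complex.ofReal_injective.subsingleton_image_iff]
  constructor
  · intro h
    by_contra! hall
    have := h (show (1 : ℝ) ∈ _ from ⟨by norm_num, hall 1 (by norm_num)⟩)
      (show (-1 : ℝ) ∈ _ from ⟨by norm_num, hall (-1) (by norm_num)⟩)
    norm_num at this
  · rintro ⟨e, he, h0⟩ x ⟨hx, hx0⟩ y ⟨hy, hy0⟩
    rcases sq_eq_one_iff.1 he with rfl | rfl <;> rcases sq_eq_one_iff.1 hx with rfl | rfl <;>
      rcases sq_eq_one_iff.1 hy with rfl | rfl <;> first | rfl | contradiction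

/-- The uniqueness theorem for the right reflection coefficient. -/
theorem exists_shift_of_reflectionPlus {J J' : JacobiCoeff}
    (hstates : J.halfBoundStates.Subsingleton ∨ J.eigenvalues.Nonempty)
    (hsame : J.halfBoundStates.Subsingleton ↔ J'.halfBoundStates.Subsingleton)
    (hR : SameZerosAndPoles J.reflectionPlus J'.reflectionPlus)
    (hR0 : J.halfBoundStates.Nonempty → SameParityAtZero J.reflectionPlus J'.reflectionPlus) :
    ∃ j : ℤ, ∀ n : ℤ, J'.a n = J.a (n - j) ∧ J'.b n = J.b (n - j) := by
  obtain ⟨N₁, hN₁⟩ := J.exists_right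
  obtain ⟨N₂, hN₂⟩ := J'.exists_right
  obtain ⟨N, h1, h2⟩ : ∃ N, N₁ ≤ N ∧ N₂ ≤ N := ⟨_, le_max_left _ _, le_max_right _ _⟩
  replace hN₁ : ∀ n, N ≤ n → J.a n = 1 ∧ J.b n = 0 := fun n hn => hN₁ n (h1.trans hn)
  replace hN₂ : ∀ n, N ≤ n → J'.a n = 1 ∧ J'.b n = 0 := fun n hn => hN₂ n (h2.trans hn)
  obtain ⟨h, hh⟩ := J.exists_isJostPolynomial
  obtain ⟨h', hh'⟩ := J'.exists_isJostPolynomial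
  have P := hh.isScatteringPair (hN₁ N le_rfl).1
  have P' := hh'.isScatteringPair (hN₂ N le_rfl).1
  have hw : ∀ z, z ≠ 0 → J.w z = aeval z (h (N + 1) - X ^ 2 * h N) := fun z hz => hh.w_eq hN₁ hz
  have hw' : ∀ z, z ≠ 0 → J'.w z = aeval z (h' (N + 1) - X ^ 2 * h' N) :=
    fun z hz => hh'.w_eq hN₂ hz
  rw [halfBoundStates_subsingleton_iff hw, halfBoundStates_subsingleton_iff hw'] at hsame
  rw [halfBoundStates_subsingleton_iff hw] at hstates
  rw [halfBoundStates_eq_image hw, Set.image_nonempty] at hR0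
  replace hstates := hstates.imp_right fun ⟨z, hz0, hz1, hz⟩ =>
    (⟨z, hz0, hz1, by rwa [← hw z hz0]⟩ : ∃ z : ℂ, z ≠ 0 ∧ ‖z‖ < 1 ∧
      aeval z (h (N + 1) - X ^ 2 * h N) = 0)
  have hS := P.ne_zero_of_exists hstates
  have hS' : h' N - h' (N + 1) ≠ 0 := fun h0 => by
    rw [← hh'.meromorphicOrderAt_reflectionPlus_eq_top_iff hN₂ 1, hR 1 one_ne_zero,
      hh.meromorphicOrderAt_reflectionPlus_eq_top_iff hN₁ 1] at h0
    exact hS h0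
  obtain ⟨hWW, hSS, heven⟩ := P.eq_and_X_pow_mul_eq P' hS hS'
    (fun z hz => by
      have := hR z hz
      rw [hh.meromorphicOrderAt_reflectionPlus hN₁ hS,
        hh'.meromorphicOrderAt_reflectionPlus hN₂ hS', WithTop.coe_inj] at this
      simp only [if_neg hz] at this
      omega)
    (by
      by_cases hex : ∃ e : ℝ, e ^ 2 = 1 ∧ (h (N + 1) - X ^ 2 * h N).eval e ≠ 0
      · exact Or.inl ⟨hex, hsame.1 hex⟩
      · have hex' := mt hsame.2 hex
        have hz := hstates.resolve_left hex
        push Not at hex hex'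
        exact Or.inr ⟨hex, hex', hz⟩)
    (fun hne => by
      obtain ⟨k, hk⟩ := hR0 hne
      rw [hh.meromorphicOrderAt_reflectionPlus hN₁ hS,
        hh'.meromorphicOrderAt_reflectionPlus hN₂ hS', ← WithTop.coe_add, WithTop.coe_inj,
        P.rootMultiplicity_zero, P'.rootMultiplicity_zero] at hk
      rw [← Int.even_coe_nat]
      simp only [if_true] at hk
      exact ⟨((h N - h (N + 1)).map (algebraMap ℝ ℂ)).rootMultiplicity 0 + k, by
        push_cast; omega⟩)
  generalize ((h N - h (N + 1)).map (algebraMap ℝ ℂ)).rootMultiplicity 0 = m at *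
  generalize ((h' N - h' (N + 1)).map (algebraMap ℝ ℂ)).rootMultiplicity 0 = l at *
  obtain ⟨j, hj⟩ : ∃ j : ℤ, (m : ℤ) = l + 2 * j := by
    obtain ⟨r, hr⟩ := heven
    exact ⟨r - l, by omega⟩
  have hcoeff := hh.coeff_eq_of_eventually_eq hh' (N := N + |j|) (j := j) fun n hn => by
    have hj1 := neg_abs_le j
    have hj2 := abs_nonneg j
    obtain ⟨p, hp⟩ : ∃ p : ℕ, n = N + p := ⟨(n - N).toNat, by omega⟩
    obtain ⟨q, hq⟩ : ∃ q : ℕ, n + j = N + q := ⟨(n + j - N).toNat, by omega⟩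
    obtain ⟨e1, e2⟩ := hh.jost_add_nat hN₁ p
    obtain ⟨e3, e4⟩ := hh'.jost_add_nat hN₂ q
    have hpow : m + 2 * p = 2 * q + l := by omega
    have e5 : X ^ (2 * q) * (h' N - h' (N + 1)) = X ^ (2 * p) * (h N - h (N + 1)) := by
      apply mul_left_cancel₀ (pow_ne_zero m (X_ne_zero (R := ℝ)))
      rw [← mul_assoc (X ^ m) (X ^ (2 * p)), ← pow_add, hpow, pow_add]
      linear_combination X ^ (2 * q) * hSS
    rw [hq, hp]
    -- `W + S = (1 - X ^ 2) * h N`, so `W` and `S` recover the Jost polynomials far to the right.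
    have hX : (1 - X ^ 2 : ℝ[X]) ≠ 0 := fun h0 => by
      have := congrArg (eval 0) h0
      simp at this
    apply mul_left_cancel₀ hX
    linear_combination e3 - e1 + e4 - e2 + e5 + hWW
  exact ⟨j, fun n => by simpa using hcoeff (n - j)⟩

/-! ### Reflection exchanges the two reflection coefficients -/

theorem wronskian_reflect (J : JacobiCoeff) (f g : ℤ → ℂ) (n : ℤ) :
    J.reflect.wronskian (fun n => f (-n)) (fun n => g (-n)) n = -J.wronskian f g (-n - 1) := by
  simp only [wronskian, reflect, show -(n + 1) = -n - 1 by ring, sub_add_cancel]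
  ring

theorem reflect_reflect (J : JacobiCoeff) : J.reflect.reflect = J := by
  simp [reflect]

theorem jostPlus_reflect (J : JacobiCoeff) {z : ℂ} (hz : z ≠ 0) :
    J.reflect.jostPlus z = fun n => J.jostMinus z (-n) :=
  (J.reflect.existsUnique_jostPlus hz).unique (J.reflect.jostPlus_spec hz)
    ((J.isJostMinus_iff z _).1 (J.jostMinus_spec hz))

theorem jostMinus_reflect (J : JacobiCoeff) {z : ℂ} (hz : z ≠ 0) :
    J.reflect.jostMinus z = fun n => J.jostPlus z (-n) := by
  have := J.reflect.jostPlus_reflect hz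
  rw [reflect_reflect] at this
  simp [this]

theorem wronskian_jost_reflect (J : JacobiCoeff) {z : ℂ} (hz : z ≠ 0) :
    J.reflect.wronskian (J.reflect.jostPlus z) (J.reflect.jostMinus z) 0
      = J.wronskian (J.jostPlus z) (J.jostMinus z) 0 := by
  rw [J.jostPlus_reflect hz, J.jostMinus_reflect hz, wronskian_reflect,
    J.wronskian_eq_zero_index (J.jostMinus_spec hz).1 (J.jostPlus_spec hz).1]
  simp only [wronskian]
  ring

theorem w_reflect (J : JacobiCoeff) {z : ℂ} (hz : z ≠ 0) : J.reflect.w z = J.w z := by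
  rw [w, w, J.wronskian_jost_reflect hz]

theorem reflectionPlus_reflect (J : JacobiCoeff) {z : ℂ} (hz : z ≠ 0) :
    J.reflect.reflectionPlus z = J.reflectionMinus z := by
  have hi := inv_ne_zero hz
  rw [reflectionPlus, reflectionMinus, alpha, alpha, betaPlus, betaMinus,
    J.wronskian_jost_reflect hz, J.jostMinus_reflect hz, J.jostPlus_reflect hi, wronskian_reflect,
    J.wronskian_eq_zero_index (J.jostPlus_spec hz).1 (J.jostMinus_spec hi).1.inv]
  ring

theorem meromorphicOrderAt_reflectionPlus_reflect (J : JacobiCoeff) (x : ℂ) :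
    meromorphicOrderAt J.reflect.reflectionPlus x = meromorphicOrderAt J.reflectionMinus x := by
  refine meromorphicOrderAt_congr ?_
  have h1 : ∀ᶠ z in nhdsWithin x {x}ᶜ, z ≠ 0 := by
    by_cases hx : x = 0
    · subst hx
      exact self_mem_nhdsWithin
    · exact nhdsWithin_le_nhds (isOpen_ne.mem_nhds hx)
  filter_upwards [h1] with z hz using J.reflectionPlus_reflect hz

theorem halfBoundStates_reflect (J : JacobiCoeff) :
    J.reflect.halfBoundStates = J.halfBoundStates := by
  ext z
  refine and_congr_right fun hz => ?_
  rw [J.w_reflect (by rcases hz with rfl | rfl <;> norm_num)]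

theorem eigenvalues_reflect (J : JacobiCoeff) : J.reflect.eigenvalues = J.eigenvalues := by
  ext z
  refine and_congr_right fun hz => ?_
  rw [J.w_reflect hz]

end JacobiCoeff

/-! ### The uniqueness theorem -/

theorem mainTheorem2 (J J' : JacobiCoeff)
    (hstates : J.halfBoundStates.Subsingleton ∨ J.eigenvalues.Nonempty)
    (hsame : J.halfBoundStates.Subsingleton ↔ J'.halfBoundStates.Subsingleton)
    (hdata :
      (SameZerosAndPoles J.reflectionPlus J'.reflectionPlus ∧
        (J.halfBoundStates.Nonempty → SameParityAtZero J.reflectionPlus J'.reflectionPlus)) ∨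
      (SameZerosAndPoles J.reflectionMinus J'.reflectionMinus ∧
        (J.halfBoundStates.Nonempty → SameParityAtZero J.reflectionMinus J'.reflectionMinus))) :
    ∃ j : ℤ, ∀ n : ℤ, J'.a n = J.a (n - j) ∧ J'.b n = J.b (n - j) := by
  rcases hdata with ⟨hR, hR0⟩ | ⟨hR, hR0⟩
  · exact JacobiCoeff.exists_shift_of_reflectionPlus hstates hsame hR hR0
  · obtain ⟨j, hj⟩ := JacobiCoeff.exists_shift_of_reflectionPlus (J := J.reflect) (J' := J'.reflect)
      (by rwa [J.halfBoundStates_reflect, J.eigenvalues_reflect])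
      (by rwa [J.halfBoundStates_reflect, J'.halfBoundStates_reflect])
      (fun z hz => by
        rw [J.meromorphicOrderAt_reflectionPlus_reflect,
          J'.meromorphicOrderAt_reflectionPlus_reflect, hR z hz])
      (fun hne => by
        rw [J.halfBoundStates_reflect] at hne
        obtain ⟨k, hk⟩ := hR0 hne
        exact ⟨k, by rw [J.meromorphicOrderAt_reflectionPlus_reflect,
          J'.meromorphicOrderAt_reflectionPlus_reflect, hk]⟩)
    refine ⟨-j, fun n => ⟨?_, ?_⟩⟩
    · have h1 := (hj (-n - 1)).1
      simp only [JacobiCoeff.reflect] at h1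
      rw [show -(-n - 1) - 1 = n by ring, show -(-n - 1 - j) - 1 = n - -j by ring] at h1
      exact h1
    · have h1 := (hj (-n)).2
      simp only [JacobiCoeff.reflect] at h1
      rw [show -(-n) = n by ring, show -(-n - j) = n - -j by ring] at h1
      exact h1
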